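/- Let $\mathbf k$ be a totally real number field of degree $l+1$ ($l\ge 0$), and let $\sigma_0,\dots,\sigma_l$ be its field embeddings into $\mathbb R$, in any order. On $\bar M=\mathbb R^l\times\mathbb R^{l+1}$, with coordinates $(t_1,\dots,t_l;\theta_0,\dots,\theta_l)$, consider the contact form $$\bar\alpha_+=e^{t_1+\dots+t_l}\,d\theta_0+e^{-t_1}\,d\theta_1+\dots+e^{-t_l}\,d\theta_l .$$ Let $\Lambda'\subset\mathbb R^{l+1}$ be the image of the ring of integers $\mathcal O_{\mathbf k}$ under $(\sigma_0,\dots,\sigma_l)$, acting on $\bar M$ by translations of $\theta$, and let $\Lambda\subset\mathbb R^l$ be the set of vectors $(\log\sigma_1(u),\dots,\log\sigma_l(u))$, where $u$ runs over the units of $\mathcal O_{\mathbf k}$ that are positive under every embedding, acting on $\bar M$ by $$\tau\cdot(t;\theta)=\bigl(t+\tau;\ e^{-(\tau_1+\dots+\tau_l)}\theta_0,\ e^{\tau_1}\theta_1,\dots,e^{\tau_l}\theta_l\bigr).$$ Let $M_{\mathbf k}$ be the quotient of $\bar M$ by the group generated by these transformations, a smooth manifold of dimension $2l+1$, and let $\alpha_+$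 be the 1-form on $M_{\mathbf k}$ induced by $\bar\alpha_+$. A submanifold $P$ of dimension $n+1$ in a $(2n+1)$-dimensional contact manifold $(M,\xi)$, with $\xi$ cooriented, is called pre-Lagrangian if some contact form for $\xi$ restricts to a closed form on $P$. Then $\alpha_+$ is a contact form, and $(M_{\mathbf k},\ker\alpha_+)$ contains a closed (compact without boundary) pre-Lagrangian submanifold $P_0$, diffeomorphic to the torus $\mathbb T^{l+1}$, such that the restriction of $\alpha_+$ to $P_0$ is closed and the inclusion induces an injection $\pi_1(P_0)\to\pi_1(M_{\mathbf k})$ (for every base point in $P_0$). -/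

import Mathlib

open scoped Manifold ContDiff NumberField
open Set Function

noncomputable section

/-! ## Differential 1-forms, contact forms and pre-Lagrangian submanifolds -/

section Forms

/-- A (not necessarily smooth) 1-form on a manifold `M` modelled on the normed space `E`. -/
abbrev OneForm (E : Type*) [NormedAddCommGroup E] [NormedSpace ℝ E]
    (M : Type*) [TopologicalSpace M] [ChartedSpace E M] : Type _ :=
  ∀ x : M, TangentSpace 𝓘(ℝ, E) x →L[ℝ] ℝ

namespace OneForm

variable {E : Type*} [NormedAddCommGroup E] [NormedSpace ℝ E]
  {M : Type*} [TopologicalSpace M] [ChartedSpace E M]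
  {F : Type*} [NormedAddCommGroup F] [NormedSpace ℝ F]
  {N : Type*} [TopologicalSpace N] [ChartedSpace F N]

/-- The pull-back `f^* α`. When `f` is an embedding this is the restriction of `α` to the
submanifold parametrised by `f`. -/
def pullback (f : N → M) (α : OneForm E M) : OneForm F N :=
  fun x => (α (f x)).comp (mfderiv 𝓘(ℝ, F) 𝓘(ℝ, E) f x)

/-- The expression of `α` in the chart around `x₀`: the pull-back of `α` by the inverse of the
chart, a 1-form on the target of the chart, which is an open subset of `E`. -/
def inChart (α : OneForm E M) (x₀ : M) : E → E →L[ℝ] ℝ :=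
  fun y => (α ((chartAt E x₀).symm y)).comp (mfderiv 𝓘(ℝ, E) 𝓘(ℝ, E) (chartAt E x₀).symm y)

/-- A 1-form is smooth if its expressions in charts are. -/
def IsSmooth (α : OneForm E M) : Prop :=
  ∀ x₀ : M, ContDiffOn ℝ ∞ (α.inChart x₀) (chartAt E x₀).target

/-- The exterior derivative `dα` at the point `x`, computed in the chart around `x` with the
exterior derivative of forms on the vector space `E`. -/
def d (α : OneForm E M) (x : M) : (TangentSpace 𝓘(ℝ, E) x) [⋀^Fin 2]→L[ℝ] ℝ :=
  (extDeriv (fun y => ContinuousAlternatingMap.ofSubsingleton ℝ E ℝ (0 : Fin 1) (α.inChart x y))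
    (chartAt E x x)).compContinuousLinearMap (mfderiv 𝓘(ℝ, E) 𝓘(ℝ, E) (chartAt E x) x)

/-- Closed 1-forms: smooth 1-forms with vanishing exterior derivative. -/
def IsClosedForm (α : OneForm E M) : Prop :=
  α.IsSmooth ∧ ∀ x, α.d x = 0

/-- Contact forms: smooth nowhere vanishing 1-forms `α` such that `dα` is nondegenerate on the
hyperplane `ker α` at each point. -/
def IsContactForm (α : OneForm E M) : Prop :=
  α.IsSmooth ∧ ∀ x : M, α x ≠ 0 ∧
    ∀ v : TangentSpace 𝓘(ℝ, E) x, α x v = 0 →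
      (∀ w : TangentSpace 𝓘(ℝ, E) x, α x w = 0 → α.d x ![v, w] = 0) → v = 0

/-- `β` is a contact form for the cooriented contact structure `ker α`: it is a contact form, and
`ker β = ker α` as cooriented hyperplane fields. -/
def IsContactFormFor (β α : OneForm E M) : Prop :=
  β.IsContactForm ∧
    ∀ (x : M) (v : TangentSpace 𝓘(ℝ, E) x),
      (β x v = 0 ↔ α x v = 0) ∧ (0 < β x v ↔ 0 < α x v)

end OneForm

/-- The submanifold of the contact manifold `(M, ker α)` parametrised by `f : N → M` is
pre-Lagrangian: for some `n` the dimensions of `M` and `N` are `2n + 1` and `n + 1`, `α` is a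
contact form, `f` is a smooth embedding, and some contact form for `ker α` restricts to a closed
form on the submanifold. -/
def IsPreLagrangian {E : Type*} [NormedAddCommGroup E] [NormedSpace ℝ E]
    {M : Type*} [TopologicalSpace M] [ChartedSpace E M] (α : OneForm E M)
    {F : Type*} [NormedAddCommGroup F] [NormedSpace ℝ F]
    {N : Type*} [TopologicalSpace N] [ChartedSpace F N] (f : N → M) : Prop :=
  (∃ n : ℕ, Module.finrank ℝ E = 2 * n + 1 ∧ Module.finrank ℝ F = n + 1) ∧
  α.IsContactForm ∧
  Manifold.IsSmoothEmbedding 𝓘(ℝ, F) 𝓘(ℝ, E) ∞ f ∧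
  ∃ β : OneForm E M, β.IsContactFormFor α ∧ (β.pullback f : OneForm F N).IsClosedForm

end Forms

/-! ## Smooth structures on quotients -/

section Quotients

/-- Two local inverses of a local homeomorphism `f` differ locally by any continuous self-map `g`
over `f` that relates their values at one point. -/
theorem localInverse_eventuallyEq {E : Type*} [TopologicalSpace E]
    {X : Type*} [TopologicalSpace X] {f : E → X} (hf : IsLocalHomeomorph f) {a b p : E} {g : E → E}
    (hg : Continuous g) (hfg : ∀ x, f (g x) = f x)
    (hp' : f p ∈ (hf.localInverseAt b).source)
    (hgp : g p = hf.localInverseAt b (f p)) :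
    ∀ᶠ y in nhds p, hf.localInverseAt b ((hf.localInverseAt a).symm y) = g y := by
  have h1 : ∀ᶠ y in nhds p, g y ∈ (hf.localInverseAt b).target := by
    refine hg.continuousAt.eventually_mem ((hf.localInverseAt b).open_target.mem_nhds ?_)
    rw [hgp]
    exact (hf.localInverseAt b).map_source hp'
  filter_upwards [h1] with y hy
  rw [hf.localInverseAt_symm, ← hfg y]
  have := (hf.localInverseAt b).right_inv hy
  rwa [hf.localInverseAt_symm] at this

variable {E : Type*} [NormedAddCommGroup E] [NormedSpace ℝ E]
  {X : Type*} [TopologicalSpace X]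

/-- The charted space structure induced by a local homeomorphism `f : E → X` is smooth, provided
that the points of each fibre of `f` are related by smooth self-maps over `f`. -/
theorem isManifold_of_deck {f : E → X} (hf : IsLocalHomeomorph f) (hs : Surjective f)
    (hdeck : ∀ p p' : E, f p = f p' → ∃ g : E → E, ContDiff ℝ ∞ g ∧ g p = p' ∧
      ∀ x, f (g x) = f x) :
    letI : ChartedSpace E X := hf.chartedSpace hs
    IsManifold 𝓘(ℝ, E) ∞ X := by
  let _ : ChartedSpace E X := hf.chartedSpace hs
  refine isManifold_of_contDiffOn 𝓘(ℝ, E) ∞ X ?_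
  rintro e e' ⟨q, rfl⟩ ⟨q', rfl⟩
  intro p hp
  set a := hs.hasRightInverse.choose q
  set b := hs.hasRightInverse.choose q'
  simp only [chartAt_self_eq, mfld_simps] at hp
  obtain ⟨hp1, hp2⟩ := hp
  have hp2' : f p ∈ (hf.localInverseAt b).source := by
    have h := congrFun (hf.localInverseAt_symm a) p
    rw [← h]; exact hp2
  obtain ⟨g, hg, hgp, hgf⟩ := hdeck p (hf.localInverseAt b (f p))
    (hf.apply_localInverseAt_of_mem hp2').symm
  have key := localInverse_eventuallyEq (a := a) hf hg.continuous hgf hp2' hgp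
  refine (hg.contDiffAt.congr_of_eventuallyEq ?_).contDiffWithinAt
  filter_upwards [key] with y hy
  exact hy

/-- A 1-form `η` on `E` invariant under the deck transformations of `E → X` descends to `X`: when
the charts of `X` are local inverses of `E → X`, the descended form is, near each point, the
pull-back of `η` by such a local inverse. -/
def OneForm.descend (η : OneForm E E) (X : Type*) [TopologicalSpace X] [ChartedSpace E X] :
    OneForm E X :=
  fun x => (η (chartAt E x x)).comp (mfderiv 𝓘(ℝ, E) 𝓘(ℝ, E) (chartAt E x) x)

/-- The descended form pulls back to the original one. -/
theorem OneForm.pullback_descend {f : E → X} (hf : IsLocalHomeomorph f) (hs : Surjective f)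
    (η : OneForm E E)
    (hdeck : ∀ p p' : E, f p = f p' → ∃ g : E → E, ContDiff ℝ ∞ g ∧ g p = p' ∧
      (∀ x, f (g x) = f x) ∧ η.pullback g = η) :
    letI : ChartedSpace E X := hf.chartedSpace hs
    (η.descend X).pullback f = η := by
  let _ : ChartedSpace E X := hf.chartedSpace hs
  have hM : IsManifold 𝓘(ℝ, E) ∞ X := isManifold_of_deck hf hs fun p p' h =>
    let ⟨g, h1, h2, h3, _⟩ := hdeck p p' h
    ⟨g, h1, h2, h3⟩
  have hM1 : IsManifold 𝓘(ℝ, E) 1 X := .of_le (n := ∞) (by simp)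
  funext p
  set b := hs.hasRightInverse.choose (f p)
  have hb : f b = f p := hs.hasRightInverse.choose_spec (f p)
  have hsrc : f p ∈ (hf.localInverseAt b).source := by
    rw [← hb]; exact hf.apply_self_mem_localInverseAt_source
  have hchart : ∀ x, chartAt E (f p) x = hf.localInverseAt b x := fun x => by
    rfl
  obtain ⟨g, hg, hgp, hgf, hgη⟩ := hdeck p (hf.localInverseAt b (f p))
    (hf.apply_localInverseAt_of_mem hsrc).symm
  have key : (fun y => chartAt E (f p) (f y)) =ᶠ[nhds p] g := by
    filter_upwards [localInverse_eventuallyEq (a := b) hf hg.continuous hgf hsrc hgp] with y hy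
    rw [hchart, ← hy, hf.localInverseAt_symm]
  have hc : MDifferentiableAt 𝓘(ℝ, E) 𝓘(ℝ, E) (chartAt E (f p)) (f p) :=
    mdifferentiableAt_atlas (chart_mem_atlas E (f p)) (mem_chart_source E (f p))
  have hfd : MDifferentiableAt 𝓘(ℝ, E) 𝓘(ℝ, E) f p := by
    rw [mdifferentiableAt_iff]
    refine ⟨hf.continuous.continuousAt, ?_⟩
    have : writtenInExtChartAt 𝓘(ℝ, E) 𝓘(ℝ, E) p f = fun y => chartAt E (f p) (f y) := by
      funext y; rfl
    rw [this]
    have h2 := (hg.contDiffAt (x := p)).congr_of_eventuallyEq key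
    exact (h2.differentiableAt (by simp)).differentiableWithinAt
  have hcomp := mfderiv_comp p hc hfd
  have hval : chartAt E (f p) (f p) = g p := by rw [hchart, hgp]
  have h3 : mfderiv 𝓘(ℝ, E) 𝓘(ℝ, E) (chartAt E (f p) ∘ f) p = mfderiv 𝓘(ℝ, E) 𝓘(ℝ, E) g p :=
    key.mfderiv_eq
  rw [← congrFun hgη p]
  ext v
  have h4 := congrArg (fun L : E →L[ℝ] E => L v) (hcomp.symm.trans h3)
  simp only [OneForm.pullback, OneForm.descend]
  change η (chartAt E (f p) (f p)) _ = η (g p) _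
  rw [hval]
  exact congrArg (η (g p)) h4

end Quotients

/-! ## The standard torus `ℝⁿ / ℤⁿ` -/

section Torus

/-- The integer lattice `ℤⁿ` in `ℝⁿ`. -/
def intLattice (n : ℕ) : AddSubgroup (Fin n → ℝ) :=
  ((Int.castAddHom ℝ).compLeft (Fin n)).range

instance (n : ℕ) : ProperlyDiscontinuousVAdd (intLattice n) (Fin n → ℝ) where
  finite_disjoint_inter_image {A B} hA hB := by
    obtain ⟨r, hr⟩ := hA.isBounded.exists_norm_le
    obtain ⟨s, hs⟩ := hB.isBounded.exists_norm_le
    obtain ⟨m, hm⟩ := exists_nat_ge (s + r)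
    have hfin : (Set.Icc (fun _ : Fin n => -(m : ℤ)) (fun _ => (m : ℤ))).Finite :=
      Set.finite_Icc _ _
    refine Set.Finite.of_finite_image (f := Subtype.val) ?_ Subtype.val_injective.injOn
    refine (hfin.image (fun k => fun i => ((k i : ℤ) : ℝ))).subset ?_
    rintro _ ⟨⟨_, k, rfl⟩, ⟨_, ⟨x, hx, rfl⟩, hy⟩, rfl⟩
    refine ⟨k, ?_, rfl⟩
    have hb : ∀ i, |(k i : ℝ)| ≤ m := fun i => by
      have h1 := (norm_le_pi_norm _ i).trans (hs _ hy)
      have h2 := (norm_le_pi_norm _ i).trans (hr _ hx)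
      have h3 : |(k i : ℝ) + x i| ≤ s := h1
      have h4 : |x i| ≤ r := h2
      rw [abs_le] at *
      constructor <;> linarith
    constructor <;> intro i
    · exact_mod_cast (abs_le.1 (hb i)).1
    · exact_mod_cast (abs_le.1 (hb i)).2

/-- The standard `n`-dimensional torus `ℝⁿ / ℤⁿ`, with the quotient topology and the quotient
charts. -/
def Torus (n : ℕ) : Type := AddAction.orbitRel.Quotient (intLattice n) (Fin n → ℝ)

instance (n : ℕ) : TopologicalSpace (Torus n) :=
  inferInstanceAs (TopologicalSpace (AddAction.orbitRel.Quotient (intLattice n) (Fin n → ℝ)))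

instance (n : ℕ) : ChartedSpace (Fin n → ℝ) (Torus n) :=
  inferInstanceAs
    (ChartedSpace (Fin n → ℝ) (AddAction.orbitRel.Quotient (intLattice n) (Fin n → ℝ)))

instance (n : ℕ) : T2Space (Torus n) :=
  inferInstanceAs (T2Space (AddAction.orbitRel.Quotient (intLattice n) (Fin n → ℝ)))

instance (n : ℕ) : IsManifold 𝓘(ℝ, Fin n → ℝ) ∞ (Torus n) := by
  refine isManifold_of_deck
    (isAddQuotientCoveringMap_quotientMk_of_properlyDiscontinuousVAdd
      (G := intLattice n)).isCoveringMap.isLocalHomeomorph Quotient.mk_surjective ?_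
  intro p p' h
  obtain ⟨k, hk⟩ := Quotient.exact h.symm
  refine ⟨fun x => k +ᵥ x, ?_, hk, fun x => Quotient.sound ⟨k, rfl⟩⟩
  exact contDiff_const.add contDiff_id

end Torus

/-! ## The manifold attached to a totally real number field -/

namespace TotallyRealField

open NumberField

/-- The space `ℝˡ × ℝˡ⁺¹`, with coordinates `(t₁, …, t_l; θ₀, …, θ_l)`. -/
abbrev Cover (l : ℕ) : Type := (Fin l → ℝ) × (Fin (l + 1) → ℝ)

/-- The 1-form `exp (t₁ + ⋯ + t_l) dθ₀ + exp (-t₁) dθ₁ + ⋯ + exp (-t_l) dθ_l`. -/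
def coverAlphaPlus (l : ℕ) : OneForm (Cover l) (Cover l) := fun p =>
  let dθ : Fin (l + 1) → (Cover l →L[ℝ] ℝ) := fun i =>
    (ContinuousLinearMap.proj i).comp (ContinuousLinearMap.snd ℝ (Fin l → ℝ) (Fin (l + 1) → ℝ))
  Real.exp (∑ j, p.1 j) • dθ 0 + ∑ j : Fin l, Real.exp (-p.1 j) • dθ j.succ

/-- The translation by `φ` in the second factor. -/
def translation {l : ℕ} (φ : Fin (l + 1) → ℝ) : Equiv.Perm (Cover l) where
  toFun p := (p.1, p.2 + φ)
  invFun p := (p.1, p.2 - φ)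
  left_inv p := by simp
  right_inv p := by simp

/-- The factors `exp (-(τ₁ + ⋯ + τ_l)), exp τ₁, …, exp τ_l`. -/
def weight {l : ℕ} (τ : Fin l → ℝ) : Fin (l + 1) → ℝ :=
  Fin.cons (Real.exp (-∑ j, τ j)) fun j => Real.exp (τ j)

theorem weight_pos {l : ℕ} (τ : Fin l → ℝ) (i : Fin (l + 1)) : 0 < weight τ i := by
  refine Fin.cases ?_ (fun j => ?_) i <;> simp [weight, Real.exp_pos]

/-- The action of `τ ∈ ℝˡ`:
`(t, θ) ↦ (t + τ; exp (-(τ₁ + ⋯ + τ_l)) θ₀, exp τ₁ θ₁, …, exp τ_l θ_l)`. -/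
def flow {l : ℕ} (τ : Fin l → ℝ) : Equiv.Perm (Cover l) where
  toFun p := (p.1 + τ, fun i => weight τ i * p.2 i)
  invFun p := (p.1 - τ, fun i => (weight τ i)⁻¹ * p.2 i)
  left_inv p := by
    ext i
    · simp
    · simp [inv_mul_cancel_left₀ (weight_pos τ i).ne']
  right_inv p := by
    ext i
    · simp
    · simp [mul_inv_cancel_left₀ (weight_pos τ i).ne']

variable {K : Type*} [Field K] [NumberField K] {l : ℕ} (σ : Fin (l + 1) ≃ (K →+* ℝ))

/-- The lattice `Λ' ⊆ ℝˡ⁺¹`: the image of the ring of integers under `(σ₀, …, σ_l)`. -/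
def integerLattice : AddSubgroup (Fin (l + 1) → ℝ) :=
  (RingHom.pi fun i => (σ i).comp (algebraMap (𝓞 K) K)).toAddMonoidHom.range

/-- The units that are positive at every real embedding. -/
def positiveUnits (K : Type*) [Field K] : Subgroup (𝓞 K)ˣ where
  carrier := {u | ∀ s : K →+* ℝ, 0 < s (u : K)}
  mul_mem' hu hv s := by simpa using mul_pos (hu s) (hv s)
  one_mem' s := by simp
  inv_mem' {u} hu s := by
    have h : s (u : K) * s ((u⁻¹ : (𝓞 K)ˣ) : K) = 1 := by
      rw [← map_mul, ← NumberField.Units.coe_mul, mul_inv_cancel]; simp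
    exact pos_of_mul_pos_right (by rw [h]; exact one_pos) (hu s).le

/-- The lattice `Λ ⊆ ℝˡ`: the vectors `(log σ₁(u), …, log σ_l(u))` for totally positive units
`u`. -/
def unitLattice : AddSubgroup (Fin l → ℝ) where
  carrier := {τ | ∃ u ∈ positiveUnits K, ∀ j, τ j = Real.log (σ j.succ (u : K))}
  zero_mem' := ⟨1, one_mem _, by simp⟩
  add_mem' := by
    rintro _ _ ⟨u, hu, h⟩ ⟨v, hv, h'⟩
    refine ⟨u * v, mul_mem hu hv, fun j => ?_⟩
    simp [h, h', Real.log_mul (hu (σ j.succ)).ne' (hv (σ j.succ)).ne']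
  neg_mem' := by
    rintro _ ⟨u, hu, h⟩
    refine ⟨u⁻¹, inv_mem hu, fun j => ?_⟩
    have h1 : σ j.succ (u : K) * σ j.succ ((u⁻¹ : (𝓞 K)ˣ) : K) = 1 := by
      rw [← map_mul, ← NumberField.Units.coe_mul, mul_inv_cancel]; simp
    rw [eq_inv_of_mul_eq_one_right h1, Real.log_inv, Pi.neg_apply, h]

/-- The group of transformations of `ℝˡ × ℝˡ⁺¹` generated by the translations by `Λ'` and the
action of `Λ`. -/
def deckGroup : Subgroup (Equiv.Perm (Cover l)) :=
  Subgroup.closure (translation '' (integerLattice σ : Set (Fin (l + 1) → ℝ)) ∪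
    flow '' (unitLattice σ : Set (Fin l → ℝ)))

variable [IsTotallyReal K]

/-- A totally positive unit has norm one. -/
theorem prod_eq_one {u : (𝓞 K)ˣ} (hu : u ∈ positiveUnits K) : ∏ i, σ i (u : K) = 1 := by
  have h1 : |Algebra.norm ℚ (u : K)| = 1 := by
    have := NumberField.isUnit_iff_norm.1 u.isUnit
    simp only [RingOfIntegers.coe_norm] at this
    exact this
  have h2 := Algebra.norm_eq_prod_embeddings ℚ ℂ (u : K)
  have hbij : Function.Bijective (fun i : Fin (l + 1) =>
      ((Complex.ofRealHom.comp (σ i)).toRatAlgHom : K →ₐ[ℚ] ℂ)) := by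
    constructor
    · intro i j hij
      apply σ.injective
      ext x
      have := congrArg (fun g : K →ₐ[ℚ] ℂ => g x) hij
      simpa using this
    · intro g
      have hr := IsTotallyReal.complexEmbedding_isReal (g : K →+* ℂ)
      obtain ⟨i, hi⟩ := σ.surjective hr.embedding
      refine ⟨i, ?_⟩
      ext x
      simp [hi]
  rw [← Fintype.prod_bijective _ hbij (fun i => ((σ i (u : K) : ℝ) : ℂ)) _
    (fun i => by simp)] at h2
  have h3 : ((Algebra.norm ℚ (u : K) : ℚ) : ℝ) = ∏ i, σ i (u : K) := by
    apply Complex.ofReal_injective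
    rw [Complex.ofReal_prod, ← h2]; simp
  have h4 : 0 < ∏ i, σ i (u : K) := Finset.prod_pos fun i _ => hu (σ i)
  have h5 : |((Algebra.norm ℚ (u : K) : ℚ) : ℝ)| = 1 := by exact_mod_cast h1
  rwa [h3, abs_of_pos h4] at h5

theorem weight_eq {u : (𝓞 K)ˣ} (hu : u ∈ positiveUnits K) {τ : Fin l → ℝ}
    (hτ : ∀ j, τ j = Real.log (σ j.succ (u : K))) (i : Fin (l + 1)) :
    weight τ i = σ i (u : K) := by
  have hs : ∀ j, Real.exp (τ j) = σ j.succ (u : K) := fun j => by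
    rw [hτ, Real.exp_log (hu _)]
  refine Fin.cases ?_ (fun j => ?_) i
  · have h := prod_eq_one σ hu
    rw [Fin.prod_univ_succ] at h
    simp only [weight, Fin.cons_zero, Real.exp_neg, Real.exp_sum, hs]
    exact (eq_inv_of_mul_eq_one_left h).symm
  · simpa [weight] using hs j

/-- Every element of the group is `(t, θ) ↦ (t + τ, τ · θ + φ)` with `τ ∈ Λ`, `φ ∈ Λ'`. -/
theorem exists_of_mem_deckGroup {γ : Equiv.Perm (Cover l)} (hγ : γ ∈ deckGroup σ) :
    ∃ τ ∈ unitLattice σ, ∃ φ ∈ integerLattice σ, γ = translation φ * flow τ := by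
  have hflow0 : flow (0 : Fin l → ℝ) = 1 := by
    have : weight (0 : Fin l → ℝ) = 1 := by
      funext i; refine Fin.cases ?_ (fun j => ?_) i <;> simp [weight]
    ext p i <;> simp [flow, this]
  have htrans0 : translation (0 : Fin (l + 1) → ℝ) = 1 := by
    ext p i <;> simp [translation]
  have hscale : ∀ τ ∈ unitLattice σ, ∀ φ ∈ integerLattice σ,
      (fun i => weight τ i * φ i) ∈ integerLattice σ := by
    rintro τ ⟨u, hu, hτ⟩ _ ⟨a, rfl⟩
    refine ⟨u * a, ?_⟩
    funext i
    change σ i (algebraMap (𝓞 K) K (u * a)) = weight τ i * σ i (algebraMap (𝓞 K) K a)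
    rw [weight_eq σ hu hτ, map_mul, map_mul]
  have hweight : ∀ τ τ' : Fin l → ℝ, ∀ i, weight (τ + τ') i = weight τ i * weight τ' i := by
    intro τ τ' i
    refine Fin.cases ?_ (fun j => ?_) i
    · simp [weight, Finset.sum_add_distrib, ← Real.exp_add, add_comm]
    · simp [weight, Real.exp_add]
  have hmul : ∀ τ τ' : Fin l → ℝ, ∀ φ φ' : Fin (l + 1) → ℝ,
      translation φ * flow τ * (translation φ' * flow τ') =
        translation (φ + fun i => weight τ i * φ' i) * flow (τ + τ') := by
    intro τ τ' φ φ'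
    ext p i
    · simp [translation, flow]; ring
    · simp [translation, flow, hweight]; ring
  refine Subgroup.closure_induction ?_ ?_ ?_ ?_ hγ
  · rintro _ (⟨φ, hφ, rfl⟩ | ⟨τ, hτ, rfl⟩)
    · exact ⟨0, zero_mem _, φ, hφ, by rw [hflow0, mul_one]⟩
    · exact ⟨τ, hτ, 0, zero_mem _, by rw [htrans0, one_mul]⟩
  · exact ⟨0, zero_mem _, 0, zero_mem _, by rw [hflow0, htrans0, one_mul]⟩
  · rintro _ _ _ _ ⟨τ, hτ, φ, hφ, rfl⟩ ⟨τ', hτ', φ', hφ', rfl⟩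
    exact ⟨τ + τ', add_mem hτ hτ', _, add_mem hφ (hscale τ hτ φ' hφ'), hmul _ _ _ _⟩
  · rintro _ _ ⟨τ, hτ, φ, hφ, rfl⟩
    refine ⟨-τ, neg_mem hτ, _, neg_mem (hscale (-τ) (neg_mem hτ) φ hφ), ?_⟩
    rw [inv_eq_iff_mul_eq_one, hmul, add_neg_cancel, hflow0, mul_one, ← htrans0]
    congr 1
    funext i
    have h := hweight τ (-τ) i
    rw [add_neg_cancel] at h
    have h0 : weight (0 : Fin l → ℝ) i = 1 := by
      refine Fin.cases ?_ (fun j => ?_) i <;> simp [weight]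
    rw [h0] at h
    simp [← mul_assoc, ← h]

theorem contDiff_translation_mul_flow (τ : Fin l → ℝ) (φ : Fin (l + 1) → ℝ) :
    ContDiff ℝ ∞ (translation φ * flow τ : Equiv.Perm (Cover l)) := by
  change ContDiff ℝ ∞ fun p : Cover l =>
    ((p.1 + τ, (fun i => weight τ i * p.2 i) + φ) : Cover l)
  fun_prop

theorem pullback_coverAlphaPlus (τ : Fin l → ℝ) (φ : Fin (l + 1) → ℝ) :
    (coverAlphaPlus l).pullback (translation φ * flow τ : Equiv.Perm (Cover l)) =
      coverAlphaPlus l := by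
  funext p
  have hd : HasFDerivAt (translation φ * flow τ : Equiv.Perm (Cover l))
      ((ContinuousLinearMap.fst ℝ (Fin l → ℝ) (Fin (l + 1) → ℝ)).prod
        (ContinuousLinearMap.pi fun i => weight τ i • (ContinuousLinearMap.proj i).comp
          (ContinuousLinearMap.snd ℝ (Fin l → ℝ) (Fin (l + 1) → ℝ)))) p := by
    change HasFDerivAt (fun p : Cover l =>
      ((p.1 + τ, (fun i => weight τ i * p.2 i) + φ) : Cover l)) _ p
    refine (hasFDerivAt_fst.add_const τ).prodMk (HasFDerivAt.add_const φ ?_)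
    refine hasFDerivAt_pi.2 fun i => ?_
    exact (((ContinuousLinearMap.proj i).comp
      (ContinuousLinearMap.snd ℝ (Fin l → ℝ) (Fin (l + 1) → ℝ))).hasFDerivAt).const_mul _
  have hm : mfderiv 𝓘(ℝ, Cover l) 𝓘(ℝ, Cover l) (translation φ * flow τ : Equiv.Perm (Cover l)) p
      = _ := mfderiv_eq_fderiv.trans hd.fderiv
  unfold OneForm.pullback
  rw [hm]
  refine ContinuousLinearMap.ext fun v => ?_
  obtain ⟨v1, v2⟩ : Cover l := v
  change Real.exp (∑ j, (p.1 j + τ j)) * (weight τ 0 * v2 0) +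
      (∑ j : Fin l, Real.exp (-(p.1 j + τ j)) •
        (ContinuousLinearMap.proj j.succ).comp
          (ContinuousLinearMap.snd ℝ (Fin l → ℝ) (Fin (l + 1) → ℝ)) : Cover l →L[ℝ] ℝ)
        ((v1, fun i => weight τ i * v2 i) : Cover l) =
    Real.exp (∑ j, p.1 j) * v2 0 + (∑ j : Fin l, Real.exp (-p.1 j) •
        (ContinuousLinearMap.proj j.succ).comp
          (ContinuousLinearMap.snd ℝ (Fin l → ℝ) (Fin (l + 1) → ℝ)) : Cover l →L[ℝ] ℝ)
        ((v1, v2) : Cover l)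
  simp only [sum_apply, smul_apply,
    ContinuousLinearMap.comp_apply, ContinuousLinearMap.coe_snd', ContinuousLinearMap.proj_apply,
    smul_eq_mul, weight, Fin.cons_zero, Fin.cons_succ, ← mul_assoc, ← Real.exp_add,
    Finset.sum_add_distrib]
  congr 2
  · congr 1; ring
  · funext j
    congr 2; ring

instance : ContinuousConstSMul (deckGroup σ) (Cover l) where
  continuous_const_smul := by
    rintro ⟨γ, hγ⟩
    obtain ⟨τ, -, φ, -, rfl⟩ := exists_of_mem_deckGroup σ hγ
    exact (contDiff_translation_mul_flow τ φ).continuous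

instance : IsCancelSMul (deckGroup σ) (Cover l) := by
  rw [isCancelSMul_iff_eq_one_of_smul_eq]
  rintro ⟨γ, hγ⟩ p hp
  obtain ⟨τ, hτ, φ, hφ, rfl⟩ := exists_of_mem_deckGroup σ hγ
  have hp' : ((p.1 + τ, (fun i => weight τ i * p.2 i) + φ) : Cover l) = p := hp
  obtain rfl : τ = 0 := by simpa using congrArg Prod.fst hp'
  have hw : weight (0 : Fin l → ℝ) = 1 := by
    funext i; refine Fin.cases ?_ (fun j => ?_) i <;> simp [weight]
  obtain rfl : φ = 0 := by
    have := congrArg Prod.snd hp'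
    rw [hw] at this
    simpa using this
  apply Subtype.ext
  ext q i <;> simp [translation, flow, hw]

instance : ProperlyDiscontinuousSMul (deckGroup σ) (Cover l) where
  finite_disjoint_inter_image {A B} hA hB := by
    obtain ⟨r, hr⟩ := hA.isBounded.exists_norm_le
    obtain ⟨s, hs⟩ := hB.isBounded.exists_norm_le
    have habs : ∀ x ∈ A, ∀ i, |x.2 i| ≤ r := fun x hx i =>
      ((norm_le_pi_norm x.2 i).trans (norm_snd_le x)).trans (hr x hx)
    have habs' : ∀ x ∈ A, ∀ j, |x.1 j| ≤ r := fun x hx j =>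
      ((norm_le_pi_norm x.1 j).trans (norm_fst_le x)).trans (hr x hx)
    have hbs : ∀ x ∈ B, ∀ i, |x.2 i| ≤ s := fun x hx i =>
      ((norm_le_pi_norm x.2 i).trans (norm_snd_le x)).trans (hs x hx)
    have hbs' : ∀ x ∈ B, ∀ j, |x.1 j| ≤ s := fun x hx j =>
      ((norm_le_pi_norm x.1 j).trans (norm_fst_le x)).trans (hs x hx)
    -- a bound for the weights
    set W : ℝ := Real.exp (l * (r + s)) + Real.exp (r + s) with hW
    -- algebraic integers with bounded conjugates form a finite set
    have hfin := fun C : ℝ => Embeddings.finite_of_norm_le K ℂ C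
    let T : Set (K × K) :=
      {x : K | IsIntegral ℤ x ∧ ∀ g : K →+* ℂ, ‖g x‖ ≤ W} ×ˢ
        {x : K | IsIntegral ℤ x ∧ ∀ g : K →+* ℂ, ‖g x‖ ≤ s + W * r}
    have hT : T.Finite := (hfin _).prod (hfin _)
    have hemb : ∀ g : K →+* ℂ, ∃ i, ∀ x, ‖g x‖ = |σ i x| := by
      intro g
      have hg := IsTotallyReal.complexEmbedding_isReal g
      obtain ⟨i, hi⟩ := σ.surjective hg.embedding
      refine ⟨i, fun x => ?_⟩
      rw [hi, ← hg.coe_embedding_apply, Complex.norm_real, Real.norm_eq_abs]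
    let F : K × K → Equiv.Perm (Cover l) := fun x =>
      translation (fun i => σ i x.2) * flow (fun j => Real.log (σ j.succ x.1))
    refine Set.Finite.of_finite_image (f := Subtype.val) ?_ Subtype.val_injective.injOn
    refine (hT.image F).subset ?_
    rintro _ ⟨⟨γ, hγ⟩, ⟨_, ⟨x, hx, rfl⟩, hy⟩, rfl⟩
    obtain ⟨τ, ⟨u, hu, hτ⟩, _, ⟨a, rfl⟩, rfl⟩ := exists_of_mem_deckGroup σ hγ
    set φ : Fin (l + 1) → ℝ := fun i => σ i (a : K) with hφ
    have hτb : ∀ j, |τ j| ≤ r + s := fun j => by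
      have h1 : |x.1 j + τ j| ≤ s := hbs' _ hy j
      have h2 := habs' x hx j
      rw [abs_le] at *
      constructor <;> linarith
    have hwb : ∀ i, weight τ i ≤ W := by
      intro i
      refine Fin.cases ?_ (fun j => ?_) i
      · have h1 : -∑ j, τ j ≤ l * (r + s) := by
          rw [← Finset.sum_neg_distrib]
          refine (Finset.sum_le_card_nsmul Finset.univ _ (r + s) fun j _ =>
            (neg_le_abs _).trans (hτb j)).trans (by simp [mul_add])
        have h2 := Real.exp_le_exp.2 h1
        have h3 := Real.exp_pos (r + s)
        simp only [weight, Fin.cons_zero]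
        linarith
      · have h2 := Real.exp_le_exp.2 ((le_abs_self _).trans (hτb j))
        have h3 := Real.exp_pos (l * (r + s))
        simp only [weight, Fin.cons_succ]
        linarith
    refine ⟨((u : K), (a : K)), ⟨⟨RingOfIntegers.isIntegral_coe _, fun g => ?_⟩,
      ⟨RingOfIntegers.isIntegral_coe _, fun g => ?_⟩⟩, ?_⟩
    · obtain ⟨i, hi⟩ := hemb g
      rw [hi, ← weight_eq σ hu hτ, abs_of_pos (weight_pos τ i)]
      exact hwb i
    · obtain ⟨i, hi⟩ := hemb g
      rw [hi]
      have h1 : |weight τ i * x.2 i + σ i (a : K)| ≤ s := hbs _ hy i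
      have h2 : |weight τ i * x.2 i| ≤ W * r := by
        rw [abs_mul, abs_of_pos (weight_pos τ i)]
        exact mul_le_mul (hwb i) (habs x hx i) (abs_nonneg _)
          ((weight_pos τ i).le.trans (hwb i))
      rw [abs_le] at *
      constructor <;> linarith
    · have : (fun j => Real.log (σ j.succ (u : K))) = τ := by funext j; rw [hτ]
      change translation _ * flow (fun j => Real.log (σ j.succ (u : K))) = translation _ * flow τ
      rw [this]
      rfl

/-- The manifold attached to `K`: the quotient of `ℝˡ × ℝˡ⁺¹` by the group generated by `Λ` and
`Λ'`, with the quotient topology and the quotient charts. -/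
def QuotientManifold : Type := MulAction.orbitRel.Quotient (deckGroup σ) (Cover l)

instance : TopologicalSpace (QuotientManifold σ) :=
  inferInstanceAs (TopologicalSpace (MulAction.orbitRel.Quotient (deckGroup σ) (Cover l)))

instance : ChartedSpace (Cover l) (QuotientManifold σ) :=
  inferInstanceAs
    (ChartedSpace (Cover l) (MulAction.orbitRel.Quotient (deckGroup σ) (Cover l)))

instance : T2Space (QuotientManifold σ) :=
  inferInstanceAs (T2Space (MulAction.orbitRel.Quotient (deckGroup σ) (Cover l)))

/-- The quotient map. -/
def proj : Cover l → QuotientManifold σ := Quotient.mk _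

instance : IsManifold 𝓘(ℝ, Cover l) ∞ (QuotientManifold σ) := by
  refine isManifold_of_deck
    (isQuotientCoveringMap_quotientMk_of_properlyDiscontinuousSMul
      (G := deckGroup σ)).isCoveringMap.isLocalHomeomorph Quotient.mk_surjective ?_
  intro p p' h
  obtain ⟨γ, hk⟩ := Quotient.exact h.symm
  obtain ⟨τ, -, φ, -, hγ⟩ := exists_of_mem_deckGroup σ γ.2
  refine ⟨γ.1, ?_, hk, fun x => Quotient.sound ⟨γ, rfl⟩⟩
  rw [hγ]
  exact contDiff_translation_mul_flow τ φ

/-- The 1-form `α₊` on the quotient manifold, descended from `ℝˡ × ℝˡ⁺¹`. -/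
def alphaPlus : OneForm (Cover l) (QuotientManifold σ) :=
  (coverAlphaPlus l).descend (QuotientManifold σ)

/-- The defining property of `α₊`: its pull-back to `ℝˡ × ℝˡ⁺¹` is the given form. -/
theorem pullback_alphaPlus : (alphaPlus σ).pullback (proj σ) = coverAlphaPlus l := by
  refine OneForm.pullback_descend
    (isQuotientCoveringMap_quotientMk_of_properlyDiscontinuousSMul
      (G := deckGroup σ)).isCoveringMap.isLocalHomeomorph Quotient.mk_surjective _ ?_
  intro p p' h
  obtain ⟨γ, hk⟩ := Quotient.exact h.symm
  obtain ⟨τ, -, φ, -, hγ⟩ := exists_of_mem_deckGroup σ γ.2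
  refine ⟨γ.1, ?_, hk, fun x => Quotient.sound ⟨γ, rfl⟩, ?_⟩
  · rw [hγ]
    exact contDiff_translation_mul_flow τ φ
  · rw [hγ]
    exact pullback_coverAlphaPlus τ φ

end TotallyRealField

end

noncomputable section

/-! ## Manifolds with charts inverse to a single map -/

section ChartsInverseTo

variable {E : Type*} [NormedAddCommGroup E] [NormedSpace ℝ E]
  {X : Type*} [TopologicalSpace X] [ChartedSpace E X] {f : E → X}

/-! The submanifold is the image of the slice `t = 0`. Every deck transformation has the form `(t,
θ) ↦ (t + τ, τ · θ + φ)`, so one that carries a point of the slice into the slice has `τ = 0` and is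
a translation by `Λ'` (`proj_zero_eq_iff`). The image is therefore `ℝˡ⁺¹ / Λ'`. It is a torus
because `Λ'` is a full lattice: the matrix of the real embeddings on an integral basis is
invertible, by linear independence of characters (`exists_equiv_integerLattice`).

The coefficients of the form depend on `t` alone. Hence it is constant on the slice, and its
restriction to the torus is closed; `α₊` itself serves as the contact form in the pre-Lagrangian
condition. The contact condition is linear algebra on the cover (`coverForm_nondegenerate`).

For fundamental groups, the torus lifts to the injective map `y ↦ (0, A y)` from the simply
connected space `ℝˡ⁺¹`. A loop of the torus that becomes null-homotopic has a closed lift in the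
cover, hence a closed lift in `ℝˡ⁺¹`, hence is null-homotopic
(`injective_fundamentalGroup_map_of_lift`).

The charts of both quotients are local inverses of one covering map, so the differential-geometric
claims can be checked on the covering spaces (`OneForm.inChart_eq_pullback`,
`isImmersionOfComplement_of_lift`). -/

/-- If the charts of `X` are local inverses of `f` and the fibres of `f` are permuted by smooth
maps over `f`, then every local inverse of `f` is a chart of the smooth structure. -/
theorem mem_maximalAtlas_of_symm_eq (hX : ∀ e ∈ atlas E X, ⇑e.symm = f)
    (hdeck : ∀ p p' : E, f p = f p' → ∃ g : E → E, ContDiff ℝ ∞ g ∧ g p = p' ∧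
      ∀ x, f (g x) = f x)
    {e : OpenPartialHomeomorph X E} (he : ⇑e.symm = f) :
    e ∈ IsManifold.maximalAtlas 𝓘(ℝ, E) ∞ X := by
  have key : ∀ e₁ e₂ : OpenPartialHomeomorph X E, ⇑e₁.symm = f → ⇑e₂.symm = f →
      ContDiffOn ℝ ∞ (e₁.symm ≫ₕ e₂) (e₁.symm ≫ₕ e₂).source := by
    intro e₁ e₂ h₁ h₂ p hp
    simp only [mfld_simps, h₁] at hp
    -- The deck map `g` taking `p` to `e₂ (f p)` is the transition map near `p`: where `g y` lies in
    -- the target of `e₂`, one has `e₂ (f y) = e₂ (f (g y)) = g y`.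
    obtain ⟨g, hg, hgp, hgf⟩ := hdeck p (e₂ (f p)) (by
      rw [← congrFun h₂ (e₂ (f p)), e₂.left_inv hp.2])
    have hmem : ∀ᶠ y in nhds p, g y ∈ e₂.target :=
      hg.continuous.continuousAt.eventually_mem
        (e₂.open_target.mem_nhds (hgp ▸ e₂.map_source hp.2))
    refine (hg.contDiffAt.congr_of_eventuallyEq ?_).contDiffWithinAt
    filter_upwards [hmem] with y hy
    have h := e₂.right_inv hy
    rw [h₂, hgf] at h
    simpa [h₁] using h
  have hgr : ∀ e₁ e₂ : OpenPartialHomeomorph X E, ⇑e₁.symm = f → ⇑e₂.symm = f →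
      e₁.symm ≫ₕ e₂ ∈ contDiffGroupoid ∞ 𝓘(ℝ, E) := by
    intro e₁ e₂ h₁ h₂
    refine mem_groupoid_of_pregroupoid.2 ⟨?_, ?_⟩
    · simpa [contDiffPregroupoid] using key e₁ e₂ h₁ h₂
    · simpa [contDiffPregroupoid] using key e₂ e₁ h₂ h₁
  exact IsManifold.mem_maximalAtlas_iff.2 (mem_maximalAtlas_iff.2 fun e' he' =>
    ⟨hgr e e' he (hX e' he'), hgr e' e (hX e' he') he⟩)

/-- A local homeomorphism whose local inverses are charts is smooth. -/
theorem contMDiff_of_symm_eq (hX : ∀ e ∈ atlas E X, ⇑e.symm = f)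
    (hdeck : ∀ p p' : E, f p = f p' → ∃ g : E → E, ContDiff ℝ ∞ g ∧ g p = p' ∧
      ∀ x, f (g x) = f x)
    (hf : IsLocalHomeomorph f) : ContMDiff 𝓘(ℝ, E) 𝓘(ℝ, E) ∞ f := by
  intro p
  have h := contMDiffOn_symm_of_mem_maximalAtlas
    (mem_maximalAtlas_of_symm_eq hX hdeck (hf.localInverseAt_symm p))
  rw [hf.localInverseAt_symm] at h
  exact h.contMDiffAt ((hf.localInverseAt p).open_target.mem_nhds hf.self_mem_localInverseAt_target)

/-- A map that lifts to an injective linear map with a complement is an immersion. -/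
theorem isImmersionOfComplement_of_lift
    {E' : Type*} [NormedAddCommGroup E'] [NormedSpace ℝ E']
    {F : Type*} [NormedAddCommGroup F] [NormedSpace ℝ F]
    {X' : Type*} [TopologicalSpace X'] [ChartedSpace E' X'] {f' : E' → X'}
    (hf : IsLocalHomeomorph f) (hs : Surjective f) (hf' : IsLocalHomeomorph f')
    (hX : ∀ e : OpenPartialHomeomorph X E, ⇑e.symm = f →
      e ∈ IsManifold.maximalAtlas 𝓘(ℝ, E) ∞ X)
    (hX' : ∀ e : OpenPartialHomeomorph X' E', ⇑e.symm = f' →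
      e ∈ IsManifold.maximalAtlas 𝓘(ℝ, E') ∞ X')
    (A : (E × F) ≃L[ℝ] E') {i : X → X'} (hi : ∀ y, i (f y) = f' (A (y, 0))) :
    Manifold.IsImmersionOfComplement F 𝓘(ℝ, E) 𝓘(ℝ, E') ∞ i := by
  intro x
  obtain ⟨c, rfl⟩ := hs x
  set e₂ := hf'.localInverseAt (A (c, 0)) with he₂
  have hopen : IsOpen ((fun y : E => A (y, 0)) ⁻¹' e₂.target) :=
    e₂.open_target.preimage (A.continuous.comp (by fun_prop))
  -- The chart upstairs is shrunk so that its slice `A (y, 0)` stays inside the target of `e₂`. In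
  -- the charts `e₀.symm` and `e₂` the map `i` is then exactly `y ↦ A (y, 0)`.
  set e₀ := (hf.localInverseAt c).symm.restrOpen _ hopen with he₀
  have hsymm : ⇑e₀.symm.symm = f := by simp [he₀]
  have hsrc : ∀ y ∈ e₀.symm.target, A (y, 0) ∈ e₂.target := fun y hy => by
    have : y ∈ (hf.localInverseAt c).target ∩ ((fun y : E => A (y, 0)) ⁻¹' e₂.target) := by
      simpa [he₀] using hy
    exact this.2
  have hc : c ∈ e₀.symm.target := by
    simp only [he₀, OpenPartialHomeomorph.symm_target, OpenPartialHomeomorph.restrOpen_source]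
    exact ⟨hf.self_mem_localInverseAt_target, hf'.self_mem_localInverseAt_target⟩
  refine Manifold.IsImmersionAtOfComplement.mk_of_charts A e₀.symm e₂ ?_ ?_
    (hX _ hsymm) (hX' _ (hf'.localInverseAt_symm _)) ?_ ?_
  · have := e₀.symm.map_target hc
    rwa [hsymm] at this
  · rw [hi]; exact hf'.apply_self_mem_localInverseAt_source
  · intro z hz
    have h1 := e₀.symm.map_source hz
    have h2 := e₀.symm.left_inv hz
    rw [hsymm] at h2
    rw [mem_preimage, ← h2, hi]
    have := e₂.map_target (hsrc _ h1)
    rwa [hf'.localInverseAt_symm] at this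
  · intro y hy
    have hy' : y ∈ e₀.symm.target := by simpa using hy
    have := e₂.right_inv (hsrc _ hy')
    rw [hf'.localInverseAt_symm] at this
    change e₂ (i (e₀.symm.symm y)) = A (y, 0)
    rw [hsymm, hi, this]

end ChartsInverseTo

/-! ### Differential forms computed on the covering space -/

namespace OneForm

variable {E : Type*} [NormedAddCommGroup E] [NormedSpace ℝ E]
  {X : Type*} [TopologicalSpace X] [ChartedSpace E X] {f : E → X}

theorem pullback_comp {F : Type*} [NormedAddCommGroup F] [NormedSpace ℝ F]
    {N : Type*} [TopologicalSpace N] [ChartedSpace F N]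
    {G : Type*} [NormedAddCommGroup G] [NormedSpace ℝ G]
    {P : Type*} [TopologicalSpace P] [ChartedSpace G P]
    (α : OneForm E X) {i : N → X} {j : P → N} (hi : MDifferentiable 𝓘(ℝ, F) 𝓘(ℝ, E) i)
    (hj : MDifferentiable 𝓘(ℝ, G) 𝓘(ℝ, F) j) :
    ((α.pullback i : OneForm F N).pullback j : OneForm G P) = α.pullback (i ∘ j) := by
  funext x
  simp only [pullback]
  rw [mfderiv_comp x (hi (j x)) (hj x)]
  rfl

/-- All inverse charts are the same map `f`, so the local expressions of `α` coincide with one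
global form on `E`. This reduces smoothness and exterior derivatives on `X` to calculus on `E`. -/
theorem inChart_eq_pullback (hX : ∀ e ∈ atlas E X, ⇑e.symm = f) (α : OneForm E X) (x : X) :
    α.inChart x = (α.pullback f : OneForm E E) := by
  have h := hX _ (chart_mem_atlas E x)
  subst h
  rfl

theorem isSmooth_of_pullback (hX : ∀ e ∈ atlas E X, ⇑e.symm = f) {α : OneForm E X}
    {η : E → E →L[ℝ] ℝ} (hα : α.pullback f = η) (hη : ContDiff ℝ ∞ η) : α.IsSmooth := by
  intro x
  rw [inChart_eq_pullback hX, hα]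
  exact hη.contDiffOn

/-- For constant vector fields `v`, `w` the bracket term of Cartan's formula vanishes, leaving two
directional derivatives. -/
theorem extDeriv_ofSubsingleton_apply {η : E → E →L[ℝ] ℝ} {p : E}
    (hη : DifferentiableAt ℝ η p) (v w : E) :
    extDeriv (fun y => ContinuousAlternatingMap.ofSubsingleton ℝ E ℝ (0 : Fin 1) (η y)) p ![v, w] =
      fderiv ℝ (fun y => η y w) p v - fderiv ℝ (fun y => η y v) p w := by
  have hd : DifferentiableAt ℝ
      (fun y => ContinuousAlternatingMap.ofSubsingleton ℝ E ℝ (0 : Fin 1) (η y)) p :=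
    (ContinuousAlternatingMap.ofSubsingletonLIE (𝕜 := ℝ) (E := E) (F := ℝ)
      (0 : Fin 1)).toContinuousLinearEquiv.differentiableAt.comp p hη
  rw [extDeriv_apply hd]
  simp [Fin.sum_univ_two, Fin.removeNth, sub_eq_add_neg]

theorem d_apply_of_pullback (hX : ∀ e ∈ atlas E X, ⇑e.symm = f) {α : OneForm E X}
    {η : E → E →L[ℝ] ℝ} (hα : α.pullback f = η) (hη : Differentiable ℝ η) (x : X)
    {D : E →L[ℝ] E} (hD : mfderiv 𝓘(ℝ, E) 𝓘(ℝ, E) (chartAt E x) x = D) (v w : E) :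
    α.d x ![v, w] = fderiv ℝ (fun y => η y (D w)) (chartAt E x x) (D v) -
      fderiv ℝ (fun y => η y (D v)) (chartAt E x x) (D w) := by
  rw [← extDeriv_ofSubsingleton_apply hη.differentiableAt]
  unfold d
  rw [inChart_eq_pullback hX, hα, hD]
  refine (ContinuousAlternatingMap.compContinuousLinearMap_apply _ _ _).trans ?_
  congr 1
  funext i
  fin_cases i <;> rfl

/-- A form whose pull-back by the covering map is constant is closed. -/
theorem isClosedForm_of_pullback_const (hX : ∀ e ∈ atlas E X, ⇑e.symm = f) {α : OneForm E X}
    {η : E →L[ℝ] ℝ} (hα : α.pullback f = fun _ => η) : α.IsClosedForm := by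
  refine ⟨isSmooth_of_pullback hX hα contDiff_const, fun x => ?_⟩
  unfold d
  rw [inChart_eq_pullback hX, hα]
  have h0 : extDeriv (fun _ : E => ContinuousAlternatingMap.ofSubsingleton ℝ E ℝ (0 : Fin 1) η)
      (chartAt E x x) = 0 := by
    refine ContinuousAlternatingMap.ext fun v => ?_
    rw [extDeriv_apply (differentiableAt_const _)]
    simp
  refine ContinuousAlternatingMap.ext fun v => ?_
  exact (ContinuousAlternatingMap.compContinuousLinearMap_apply _ _ _).trans
    (congrArg (fun ζ : E [⋀^Fin 2]→L[ℝ] ℝ => ζ _) h0)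

/-- A form descended from a contact form is a contact form. -/
theorem isContactForm_of_pullback [IsManifold 𝓘(ℝ, E) 1 X]
    (hX : ∀ e ∈ atlas E X, ⇑e.symm = f) {η : E → E →L[ℝ] ℝ}
    (hα : (descend η X).pullback f = η) (hη : ContDiff ℝ ∞ η) (hne : ∀ p, η p ≠ 0)
    (hnd : ∀ p v, η p v = 0 → (∀ w, η p w = 0 →
      fderiv ℝ (fun y => η y w) p v - fderiv ℝ (fun y => η y v) p w = 0) → v = 0) :
    (descend η X : OneForm E X).IsContactForm := by
  refine ⟨isSmooth_of_pullback hX hα hη, fun x => ?_⟩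
  -- The derivative `D` of the chart identifies the tangent space at `x` with `E`, and carries the
  -- contact condition at `x` to the one for `η` at `chartAt E x x`.
  obtain ⟨D, hD⟩ : ∃ D : E →L[ℝ] E, mfderiv 𝓘(ℝ, E) 𝓘(ℝ, E) (chartAt E x) x = D := ⟨_, rfl⟩
  have hbij : Bijective D := hD ▸
    (mdifferentiable_of_mem_atlas (chart_mem_atlas E x)).mfderiv_bijective (mem_chart_source E x)
  have hval : ∀ v : E, descend η X x v = η (chartAt E x x) (D v) := fun v => by rw [← hD]; rfl
  refine ⟨fun h => hne (chartAt E x x) ?_, fun v hv hvw => ?_⟩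
  · refine ContinuousLinearMap.ext fun v => ?_
    obtain ⟨w, rfl⟩ := hbij.2 v
    exact (hval w).symm.trans (congrArg (fun L : TangentSpace 𝓘(ℝ, E) x →L[ℝ] ℝ => L w) h)
  · refine hbij.1 ((hnd (chartAt E x x) (D v) (hval v ▸ hv) fun w hw => ?_).trans (map_zero D).symm)
    obtain ⟨w, rfl⟩ := hbij.2 w
    exact (d_apply_of_pullback hX hα (hη.differentiable (by simp)) x hD v w).symm.trans
      (hvw w ((hval w).trans hw))

end OneForm

/-! ## The contact form on the cover -/

namespace TotallyRealField

variable {l : ℕ}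

/-- The form `coverAlphaPlus`, with the tangent spaces of `ℝˡ × ℝˡ⁺¹` identified with
`ℝˡ × ℝˡ⁺¹`. -/
def coverForm (l : ℕ) : Cover l → Cover l →L[ℝ] ℝ := fun p =>
  let dθ : Fin (l + 1) → (Cover l →L[ℝ] ℝ) := fun i =>
    (ContinuousLinearMap.proj i).comp (ContinuousLinearMap.snd ℝ (Fin l → ℝ) (Fin (l + 1) → ℝ))
  Real.exp (∑ j, p.1 j) • dθ 0 + ∑ j : Fin l, Real.exp (-p.1 j) • dθ j.succ

theorem coverForm_apply (p v : Cover l) :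
    coverForm l p v =
      Real.exp (∑ j, p.1 j) * v.2 0 + ∑ j : Fin l, Real.exp (-p.1 j) * v.2 j.succ := by
  simp [coverForm, sum_apply]

theorem contDiff_coverForm :
    ContDiff ℝ ∞ (coverForm l) := by
  unfold coverForm
  fun_prop

theorem fderiv_coverForm_apply (p v w : Cover l) :
    fderiv ℝ (fun y => coverForm l y w) p v =
      Real.exp (∑ j, p.1 j) * (∑ j, v.1 j) * w.2 0 -
        ∑ j : Fin l, Real.exp (-p.1 j) * v.1 j * w.2 j.succ := by
  have hd : DifferentiableAt ℝ (fun y => coverForm l y w) p :=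
    ((contDiff_coverForm.differentiable (by simp)).clm_apply
      (differentiable_const w)).differentiableAt
  -- Restricting to the line `p + t v` turns the computation into a one-variable derivative of
  -- exponentials.
  rw [← hd.lineDeriv_eq_fderiv]
  refine HasLineDerivAt.lineDeriv ?_
  unfold HasLineDerivAt
  simp only [coverForm_apply, Prod.fst_add, Prod.smul_fst, Pi.add_apply, Pi.smul_apply,
    smul_eq_mul]
  have hlin : ∀ j, HasDerivAt (fun t : ℝ => p.1 j + t * v.1 j) (v.1 j) 0 := fun j => by
    simpa using ((hasDerivAt_id (0 : ℝ)).mul_const (v.1 j)).const_add (p.1 j)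
  have h0 := ((HasDerivAt.fun_sum fun j (_ : j ∈ Finset.univ) => hlin j).exp).mul_const (w.2 0)
  have h1 := HasDerivAt.fun_sum fun j (_ : j ∈ Finset.univ) =>
    ((hlin j).neg.exp).mul_const (w.2 j.succ)
  refine (h0.add h1).congr_deriv ?_
  simp [sub_eq_add_neg]

theorem coverForm_ne_zero (p : Cover l) : coverForm l p ≠ 0 := by
  intro h
  have h1 := coverForm_apply p ((0, Pi.single 0 1) : Cover l)
  rw [h] at h1
  simp at h1
  exact (Real.exp_pos _).ne h1

/-- Testing against the directions `∂/∂t_j`, which lie in the kernel, kills the `θ`-part of `v`. A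
suitable `θ`-direction in the kernel then makes the pairing equal to the sum of the squares of the
`t`-components. -/
theorem coverForm_nondegenerate (p v : Cover l)
    (hv : coverForm l p v = 0)
    (h : ∀ w : Cover l, coverForm l p w = 0 →
      fderiv ℝ (fun y => coverForm l y w) p v -
        fderiv ℝ (fun y => coverForm l y v) p w = 0) : v = 0 := by
  simp only [fderiv_coverForm_apply] at h
  simp only [coverForm_apply] at h hv
  have hl : (l : ℝ) + 1 ≠ 0 := by positivity
  -- The pairing with `∂/∂t_j` says that all `l + 1` terms of `coverForm l p v` are equal. Their sum
  -- is zero by `hv`, so each vanishes.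
  have hs : ∀ j : Fin l, Real.exp (-p.1 j) * v.2 j.succ = Real.exp (∑ j, p.1 j) * v.2 0 := by
    intro j
    have h1 := h (Pi.single j 1, 0) (by simp)
    simp [Pi.single_apply] at h1
    linarith
  have h0 : v.2 0 = 0 := by
    simp only [hs, Finset.sum_const, Finset.card_univ, Fintype.card_fin, nsmul_eq_mul] at hv
    have h2 : ((l : ℝ) + 1) * (Real.exp (∑ j, p.1 j) * v.2 0) = 0 := by linarith
    simpa [hl, Real.exp_ne_zero] using h2
  have hθ : v.2 = 0 := by
    funext i
    refine Fin.cases h0 (fun j => ?_) i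
    have := hs j
    rw [h0, mul_zero] at this
    simpa [Real.exp_ne_zero] using this
  -- The test vector has weighted `θ`-components `c` and `c - v.1 j`. Their sum is `(l + 1) c - ∑
  -- v.1 j`, so this `c` puts it in the kernel; in the pairing the terms in `c` cancel.
  set c : ℝ := (∑ j, v.1 j) / (l + 1) with hc
  have hc' : (l + 1) * c = ∑ j, v.1 j := by rw [hc]; field_simp
  have hexp : ∀ x y : ℝ, Real.exp (-x) * (Real.exp x * y) = y := fun x y => by
    rw [← mul_assoc, ← Real.exp_add]; simp
  have hexp' : ∀ x y : ℝ, Real.exp x * (Real.exp (-x) * y) = y := fun x y => by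
    rw [← mul_assoc, ← Real.exp_add]; simp
  have h3 := h (0, Fin.cons (Real.exp (-∑ j, p.1 j) * c)
    fun j => Real.exp (p.1 j) * (c - v.1 j)) (by
      simp only [Fin.cons_zero, Fin.cons_succ, hexp, hexp', Finset.sum_sub_distrib,
        Finset.sum_const, Finset.card_univ, Fintype.card_fin, nsmul_eq_mul]
      linarith)
  have hcomm : ∀ j, Real.exp (-p.1 j) * v.1 j * (Real.exp (p.1 j) * (c - v.1 j)) =
      v.1 j * c - v.1 j ^ 2 := fun j => by
    have := hexp (p.1 j) (v.1 j * (c - v.1 j))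
    linear_combination this
  have hcomm' : Real.exp (∑ j, p.1 j) * (∑ j, v.1 j) * (Real.exp (-∑ j, p.1 j) * c) =
      (∑ j, v.1 j) * c := by
    have := hexp' (∑ j, p.1 j) ((∑ j, v.1 j) * c)
    linear_combination this
  simp only [Fin.cons_zero, Fin.cons_succ, hcomm, hcomm', hθ, Finset.sum_sub_distrib,
    ← Finset.sum_mul] at h3
  have h4 : ∑ j, v.1 j ^ 2 = 0 := by simpa using h3
  have h5 : v.1 = 0 := by
    funext j
    have := (Finset.sum_eq_zero_iff_of_nonneg fun j _ => sq_nonneg (v.1 j)).1 h4 j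
      (Finset.mem_univ j)
    simpa using this
  exact Prod.ext h5 hθ

/-! ## The lattice of integers -/

variable {K : Type*} [Field K] [NumberField K] [NumberField.IsTotallyReal K]
  (σ : Fin (l + 1) ≃ (K →+* ℝ))

open NumberField

/-- The rank is the number of complex embeddings, all of which are real since `K` is totally real.
-/
theorem finrank_ringOfIntegers (σ : Fin (l + 1) ≃ (K →+* ℝ)) :
    Module.finrank ℤ (𝓞 K) = l + 1 := by
  rw [RingOfIntegers.rank, ← Embeddings.card K ℂ, ← Fintype.card_fin (l + 1)]
  refine (Fintype.card_of_bijective (f := fun i => Complex.ofRealHom.comp (σ i)) ⟨?_, ?_⟩).symm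
  · intro i j hij
    refine σ.injective (RingHom.ext fun x => Complex.ofReal_injective ?_)
    exact congrArg (fun g : K →+* ℂ => g x) hij
  · intro g
    have hr := IsTotallyReal.complexEmbedding_isReal g
    obtain ⟨i, hi⟩ := σ.surjective hr.embedding
    refine ⟨i, RingHom.ext fun x => ?_⟩
    simp [hi]

/-- The lattice `Λ'` is the image of `ℤˡ⁺¹` under a linear automorphism. -/
theorem exists_equiv_integerLattice :
    ∃ A : (Fin (l + 1) → ℝ) ≃L[ℝ] (Fin (l + 1) → ℝ),
      ∀ y, A y ∈ integerLattice σ ↔ y ∈ intLattice (l + 1) := by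
  let b : Module.Basis (Fin (l + 1)) ℤ (𝓞 K) :=
    Module.finBasisOfFinrankEq ℤ (𝓞 K) (finrank_ringOfIntegers σ)
  let M : Matrix (Fin (l + 1)) (Fin (l + 1)) ℝ := Matrix.of fun i k => σ i (b k : K)
  -- A linear relation among the rows is a relation among the `σ i` on the basis `b`. It extends to
  -- `𝓞 K` by additivity and to `K` by clearing denominators, where Dedekind's independence of
  -- characters makes it trivial.
  have hM : IsUnit M := by
    rw [← Matrix.linearIndependent_rows_iff_isUnit, Fintype.linearIndependent_iff]
    intro c hc
    have hb : ∀ k, ∑ i, c i * σ i (b k : K) = 0 := fun k => by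
      simpa [M, Matrix.row] using congrFun hc k
    have hO : ∀ a : 𝓞 K, ∑ i, c i * σ i (a : K) = 0 := by
      intro a
      let ψ : 𝓞 K →+ ℝ := ∑ i, (AddMonoidHom.mulLeft (c i)).comp
        ((σ i).comp (algebraMap (𝓞 K) K)).toAddMonoidHom
      have hψ : ∀ a, ψ a = ∑ i, c i * σ i (a : K) := fun a => by simp [ψ]
      have h0 : ψ.toIntLinearMap = 0 := b.ext fun k => by simpa [hψ] using hb k
      rw [← hψ]
      exact congrArg (fun g : 𝓞 K →ₗ[ℤ] ℝ => g a) h0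
    have hK : ∀ x : K, ∑ i, c i * σ i x = 0 := by
      intro x
      obtain ⟨d, hd, hint⟩ := IsAlgebraic.exists_integral_multiple
        ((IsFractionRing.isAlgebraic_iff ℤ ℚ K).2 (Algebra.IsAlgebraic.isAlgebraic (R := ℚ) x))
      obtain ⟨a, ha⟩ : ∃ a : 𝓞 K, (a : K) = d • x := ⟨⟨d • x, hint⟩, rfl⟩
      have h := hO a
      have h' : (d : ℝ) * ∑ i, c i * σ i x = 0 := by
        rw [← h, Finset.mul_sum]
        refine Finset.sum_congr rfl fun i _ => ?_
        rw [ha, zsmul_eq_mul, map_mul, map_intCast]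
        ring
      exact (mul_eq_zero.1 h').resolve_left (by exact_mod_cast hd)
    have hli := (linearIndependent_monoidHom K ℝ).comp
      (fun i => ((σ i : K →+* ℝ) : K →* ℝ)) (fun i j hij => σ.injective
        (RingHom.ext fun x => congrArg (fun g : K →* ℝ => g x) hij))
    rw [Fintype.linearIndependent_iff] at hli
    refine hli c (funext fun x => ?_)
    simpa using hK x
  let A : (Fin (l + 1) → ℝ) ≃L[ℝ] (Fin (l + 1) → ℝ) :=
    (LinearEquiv.ofBijective M.mulVecLin
      ⟨Matrix.mulVec_injective_of_isUnit hM,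
        Matrix.mulVec_surjective_iff_isUnit.2 hM⟩).toContinuousLinearEquiv
  have hA : ∀ k : Fin (l + 1) → ℤ, A (fun i => (k i : ℝ)) =
      fun i => σ i ((∑ j, k j • b j : 𝓞 K) : K) := by
    intro k
    funext i
    change (M.mulVec fun i => (k i : ℝ)) i = _
    simp [Matrix.mulVec, dotProduct, M, mul_comm]
  refine ⟨A, fun y => ⟨?_, ?_⟩⟩
  · rintro ⟨a, ha⟩
    refine ⟨b.repr a, A.injective ((hA _).trans ?_)⟩
    rw [b.sum_repr]
    exact ha
  · rintro ⟨k, rfl⟩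
    exact ⟨∑ j, k j • b j, (hA k).symm⟩

end TotallyRealField
/-! ## Coverings and fundamental groups -/

/-- A map is injective on fundamental groups if it lifts to an injective map from a simply
connected covering space. -/
theorem injective_fundamentalGroup_map_of_lift {E E' X X' : Type*} [TopologicalSpace E]
    [TopologicalSpace E'] [TopologicalSpace X] [TopologicalSpace X'] [SimplyConnectedSpace E]
    {G : Type*} [AddGroup G] [AddAction G E] {f : E → X} {f' : E' → X'}
    (hf : IsAddQuotientCoveringMap f G) (hf' : IsCoveringMap f')
    {i : C(X, X')} {j : C(E, E')} (hj : Injective j) (hij : ∀ y, i (f y) = f' (j y)) (x : X) :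
    Injective (FundamentalGroup.map i x) := by
  rw [injective_iff_map_eq_one]
  obtain ⟨c, rfl⟩ := hf.surjective x
  suffices key : ∀ a : Path.Homotopic.Quotient (f c) (f c), a.map i = .refl _ → a = .refl _ from
    fun a ha => key a ha
  intro a ha
  -- `Γ` lifts `a` starting at `c`, and `e'` is its endpoint; the goal is to show that this lift is
  -- closed.
  let e : f ⁻¹' {f c} := ⟨c, rfl⟩
  set e' := hf.isCoveringMap.monodromy a e with he'
  let Γ := hf.isCoveringMap.liftPathQuotient a e
  have hΓ : Γ.map ⟨f, hf.isCoveringMap.continuous⟩ = a.cast e.2 e'.2 :=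
    hf.isCoveringMap.map_liftPathQuotient a e
  -- The path `j ∘ Γ` lifts the image loop, so it computes the monodromy of that loop.
  have hlift : hf'.monodromy (a.map i) ⟨j c, (hij c).symm⟩ =
      ⟨j e', by rw [mem_preimage, ← hij, show f e' = f c from e'.2]; rfl⟩ := by
    refine hf'.monodromy_eq_of_map_eq (Γ.map j) ?_
    have h1 := (congrArg (Path.Homotopic.Quotient.map · i) hΓ).trans
      (Path.Homotopic.Quotient.map_cast (hx := e.2) (hy := e'.2) a)
    have h2 : ∀ {u v : E} (γ : Path.Homotopic.Quotient u v),
        (γ.map j).map ⟨f', hf'.continuous⟩ =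
          ((γ.map ⟨f, hf.isCoveringMap.continuous⟩).map i).cast (hij u).symm (hij v).symm := by
      rintro u v ⟨γ⟩
      exact congrArg Path.Homotopic.Quotient.mk (Path.ext (funext fun t => (hij _).symm))
    rw [h2, h1, Path.Homotopic.Quotient.cast_cast]
  have hrefl : hf'.monodromy (a.map i) = id :=
    (congrArg _ ha).trans hf'.monodromy_refl
  rw [hrefl] at hlift
  have hee : e = e' := Subtype.ext (hj (congrArg Subtype.val hlift))
  -- In a quotient covering, monodromy fixing one point of the fibre is trivial. Since `E` is simply
  -- connected, trivial monodromy forces the class `a` to be trivial.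
  have hmon : hf.isCoveringMap.monodromy a = id := (hf.monodromy_eq_id_iff e).2 hee.symm
  refine hf.monodromyPerm_injective (x := f c) (a₁ := a) (a₂ := 1) ?_
  rw [map_one]
  exact Equiv.ext fun y => congrFun hmon y

/-! ## The torus -/

/-- The quotient map `ℝⁿ → ℝⁿ / ℤⁿ`. -/
def Torus.mk (n : ℕ) : (Fin n → ℝ) → Torus n := Quotient.mk _

namespace Torus

variable {n : ℕ}

theorem isAddQuotientCoveringMap_mk : IsAddQuotientCoveringMap (mk n) (intLattice n) :=
  isAddQuotientCoveringMap_quotientMk_of_properlyDiscontinuousVAdd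

theorem isLocalHomeomorph_mk : IsLocalHomeomorph (mk n) :=
  isAddQuotientCoveringMap_mk.isCoveringMap.isLocalHomeomorph

theorem surjective_mk : Surjective (mk n) := Quotient.mk_surjective

theorem mk_eq_mk_iff {x y : Fin n → ℝ} : mk n x = mk n y ↔ y - x ∈ intLattice n := by
  constructor
  · intro h
    obtain ⟨k, rfl⟩ := Quotient.exact h.symm
    change k.1 + x - x ∈ _
    simp
  · intro h
    exact (Quotient.sound ⟨⟨y - x, h⟩, sub_add_cancel y x⟩ : mk n y = mk n x).symm

theorem symm_eq_mk : ∀ e ∈ atlas (Fin n → ℝ) (Torus n), ⇑e.symm = mk n := by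
  rintro _ ⟨q, rfl⟩
  funext y
  exact congrFun (isLocalHomeomorph_mk.localInverseAt_symm _) y

theorem exists_deck (p p' : Fin n → ℝ) (h : mk n p = mk n p') :
    ∃ g : (Fin n → ℝ) → (Fin n → ℝ), ContDiff ℝ ∞ g ∧ g p = p' ∧ ∀ x, mk n (g x) = mk n x :=
  ⟨fun x => (p' - p) + x, contDiff_const.add contDiff_id, sub_add_cancel p' p, fun x =>
    (mk_eq_mk_iff.2 (by simpa using mk_eq_mk_iff.1 h)).symm⟩

instance : CompactSpace (Torus n) := by
  have hc : IsCompact (mk n '' Set.Icc 0 1) := isCompact_Icc.image isLocalHomeomorph_mk.continuous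
  refine ⟨hc.of_isClosed_subset isClosed_univ fun x _ => ?_⟩
  obtain ⟨y, rfl⟩ := surjective_mk x
  -- Fractional parts give a representative in the unit cube, whose compact image is therefore the
  -- whole torus.
  refine ⟨fun i => Int.fract (y i), ⟨fun i => Int.fract_nonneg _, fun i => (Int.fract_lt_one _).le⟩,
    mk_eq_mk_iff.2 ⟨fun i => ⌊y i⌋, ?_⟩⟩
  funext i
  change ((⌊y i⌋ : ℤ) : ℝ) = y i - Int.fract (y i)
  rw [Int.self_sub_fract]

end Torus

/-! ## The quotient manifold and the torus `t = 0` -/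

namespace TotallyRealField

variable {K : Type*} [Field K] [NumberField K] [NumberField.IsTotallyReal K] {l : ℕ}
  (σ : Fin (l + 1) ≃ (K →+* ℝ))

theorem isCoveringMap_proj : IsCoveringMap (proj σ) :=
  (isQuotientCoveringMap_quotientMk_of_properlyDiscontinuousSMul (G := deckGroup σ)).isCoveringMap

theorem symm_eq_proj : ∀ e ∈ atlas (Cover l) (QuotientManifold σ), ⇑e.symm = proj σ := by
  rintro _ ⟨q, rfl⟩
  funext y
  exact congrFun ((isCoveringMap_proj σ).isLocalHomeomorph.localInverseAt_symm _) y

theorem exists_deck (p p' : Cover l) (h : proj σ p = proj σ p') :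
    ∃ g : Cover l → Cover l, ContDiff ℝ ∞ g ∧ g p = p' ∧ ∀ x, proj σ (g x) = proj σ x := by
  obtain ⟨γ, hk⟩ := Quotient.exact h.symm
  obtain ⟨τ, -, φ, -, hγ⟩ := exists_of_mem_deckGroup σ γ.2
  refine ⟨γ.1, ?_, hk, fun x => Quotient.sound ⟨γ, rfl⟩⟩
  rw [hγ]
  exact contDiff_translation_mul_flow τ φ

theorem contMDiff_proj : ContMDiff 𝓘(ℝ, Cover l) 𝓘(ℝ, Cover l) ∞ (proj σ) :=
  contMDiff_of_symm_eq (symm_eq_proj σ) (exists_deck σ) (isCoveringMap_proj σ).isLocalHomeomorph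

theorem isContactForm_alphaPlus : (alphaPlus σ).IsContactForm := by
  have : IsManifold 𝓘(ℝ, Cover l) 1 (QuotientManifold σ) := .of_le (n := ∞) (by simp)
  exact OneForm.isContactForm_of_pullback (η := coverForm l) (symm_eq_proj σ)
    (pullback_alphaPlus σ) contDiff_coverForm coverForm_ne_zero coverForm_nondegenerate

/-- Points of the fibre `t = 0` have the same image exactly when they differ by an element
of `Λ'`. -/
theorem proj_zero_eq_iff {x y : Fin (l + 1) → ℝ} :
    proj σ (0, x) = proj σ (0, y) ↔ y - x ∈ integerLattice σ := by
  constructor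
  · intro h
    obtain ⟨γ, hk⟩ := Quotient.exact h.symm
    obtain ⟨τ, -, φ, hφ, hγ⟩ := exists_of_mem_deckGroup σ γ.2
    have hk' : γ.1 (0, x) = (0, y) := hk
    rw [hγ] at hk'
    have hk2 : ((0 + τ, (fun i => weight τ i * x i) + φ) : Cover l) = (0, y) := hk'
    -- Both points have `t = 0` and the action adds `τ` to `t`; only the translation by `φ`
    -- survives.
    obtain rfl : τ = 0 := by simpa using congrArg Prod.fst hk2
    have hw : ∀ i, weight (0 : Fin l → ℝ) i = 1 := fun i => by
      refine Fin.cases ?_ (fun j => ?_) i <;> simp [weight]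
    have hy : x + φ = y := by simpa [hw] using congrArg Prod.snd hk2
    rw [← hy]
    simpa using hφ
  · intro h
    refine (Quotient.sound ⟨⟨translation (y - x), Subgroup.subset_closure (.inl ⟨_, h, rfl⟩)⟩,
      ?_⟩ : proj σ (0, y) = proj σ (0, x)).symm
    exact Prod.ext rfl (add_sub_cancel x y)

variable {σ}

/-- The torus `t = 0`, parametrised by means of a linear isomorphism from `ℤˡ⁺¹` to `Λ'`. -/
def fibreTorus (A : (Fin (l + 1) → ℝ) ≃L[ℝ] (Fin (l + 1) → ℝ))
    (hA : ∀ y, A y ∈ integerLattice σ ↔ y ∈ intLattice (l + 1)) :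
    C(Torus (l + 1), QuotientManifold σ) where
  toFun := Quotient.lift (fun y => proj σ (0, A y)) fun x y h =>
    (proj_zero_eq_iff σ).2 <| by
      rw [← map_sub, hA]
      exact Torus.mk_eq_mk_iff.1 (Quotient.sound h)
  continuous_toFun := by
    refine Continuous.quotient_lift ?_ _
    exact (isCoveringMap_proj σ).continuous.comp (by fun_prop)

variable {A : (Fin (l + 1) → ℝ) ≃L[ℝ] (Fin (l + 1) → ℝ)}
  (hA : ∀ y, A y ∈ integerLattice σ ↔ y ∈ intLattice (l + 1))

theorem fibreTorus_mk (y : Fin (l + 1) → ℝ) :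
    fibreTorus A hA (Torus.mk (l + 1) y) = proj σ (0, A y) := rfl

theorem injective_fibreTorus : Injective (fibreTorus A hA) := by
  intro x y h
  obtain ⟨x, rfl⟩ := Torus.surjective_mk x
  obtain ⟨y, rfl⟩ := Torus.surjective_mk y
  rw [fibreTorus_mk, fibreTorus_mk, proj_zero_eq_iff, ← map_sub, hA] at h
  exact Torus.mk_eq_mk_iff.2 h

theorem isSmoothEmbedding_fibreTorus :
    Manifold.IsSmoothEmbedding 𝓘(ℝ, Fin (l + 1) → ℝ) 𝓘(ℝ, Cover l) ∞ (fibreTorus A hA) where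
  isImmersion := by
    refine (isImmersionOfComplement_of_lift (f := Torus.mk (l + 1)) (f' := proj σ)
      Torus.isLocalHomeomorph_mk Torus.surjective_mk (isCoveringMap_proj σ).isLocalHomeomorph
      (fun e he => mem_maximalAtlas_of_symm_eq Torus.symm_eq_mk Torus.exists_deck he)
      (fun e he => mem_maximalAtlas_of_symm_eq (symm_eq_proj σ) (exists_deck σ) he)
      -- The complement of the slice is the space of `t`-directions; the swap matches the order of
      -- the factors in `Cover l`.
      ((A.prodCongr (.refl ℝ (Fin l → ℝ))).trans (.prodComm ℝ _ _)) ?_).isImmersion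
    exact fun y => fibreTorus_mk hA y
  -- A continuous injection from a compact space to a Hausdorff space is a closed embedding.
  isEmbedding := ((fibreTorus A hA).continuous.isClosedEmbedding
    (injective_fibreTorus hA)).isEmbedding

/-- Pulled back to `ℝˡ⁺¹`, the form is the linear form `(coverForm l 0).comp j`, because the
coefficients of `coverForm` depend only on `t`, which is zero along `j`. -/
theorem isClosedForm_pullback_fibreTorus :
    ((alphaPlus σ).pullback (fibreTorus A hA) :
      OneForm (Fin (l + 1) → ℝ) (Torus (l + 1))).IsClosedForm := by
  let j : (Fin (l + 1) → ℝ) →L[ℝ] Cover l :=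
    (0 : (Fin (l + 1) → ℝ) →L[ℝ] (Fin l → ℝ)).prod (A : (Fin (l + 1) → ℝ) →L[ℝ] _)
  refine OneForm.isClosedForm_of_pullback_const Torus.symm_eq_mk
    (η := (coverForm l 0).comp j) ?_
  have hT := contMDiff_of_symm_eq Torus.symm_eq_mk Torus.exists_deck
    (Torus.isLocalHomeomorph_mk (n := l + 1))
  have hj : MDifferentiable 𝓘(ℝ, Fin (l + 1) → ℝ) 𝓘(ℝ, Cover l) j :=
    j.differentiable.mdifferentiable
  rw [OneForm.pullback_comp _
    ((isSmoothEmbedding_fibreTorus hA).contMDiff.mdifferentiable (by simp))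
    (hT.mdifferentiable (by simp))]
  have hcomp : fibreTorus A hA ∘ Torus.mk (l + 1) = proj σ ∘ j := rfl
  rw [hcomp, ← OneForm.pullback_comp _ ((contMDiff_proj σ).mdifferentiable (by simp)) hj,
    pullback_alphaPlus]
  funext y
  have hm : mfderiv 𝓘(ℝ, Fin (l + 1) → ℝ) 𝓘(ℝ, Cover l) j y = j :=
    mfderiv_eq_fderiv.trans j.fderiv
  unfold OneForm.pullback
  rw [hm]
  refine ContinuousLinearMap.ext fun v => ?_
  change coverForm l (j y) (j v) = coverForm l 0 (j v)
  simp [coverForm_apply, j]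

end TotallyRealField

end

theorem mainTheorem7 {K : Type*} [Field K] [NumberField K] [NumberField.IsTotallyReal K]
    {l : ℕ} (σ : Fin (l + 1) ≃ (K →+* ℝ)) :
    ∃ ι : C(Torus (l + 1), TotallyRealField.QuotientManifold σ),
      IsCompact (Set.range ι) ∧
      IsPreLagrangian (TotallyRealField.alphaPlus σ) (F := Fin (l + 1) → ℝ) ι ∧
      ((TotallyRealField.alphaPlus σ).pullback ι : OneForm (Fin (l + 1) → ℝ) (Torus (l + 1))).IsClosedForm ∧
      ∀ x : Torus (l + 1), Function.Injective (FundamentalGroup.map ι x) := by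
  obtain ⟨A, hA⟩ := TotallyRealField.exists_equiv_integerLattice σ
  have hcl := TotallyRealField.isClosedForm_pullback_fibreTorus hA
  refine ⟨TotallyRealField.fibreTorus A hA,
    isCompact_range (TotallyRealField.fibreTorus A hA).continuous,
    -- The dimensions are `l + (l + 1) = 2 * l + 1` and `l + 1`; the contact form with closed
    -- restriction is `α₊` itself.
    ⟨⟨l, by simp; ring, by simp⟩, TotallyRealField.isContactForm_alphaPlus σ,
      TotallyRealField.isSmoothEmbedding_fibreTorus hA, TotallyRealField.alphaPlus σ,
      ⟨TotallyRealField.isContactForm_alphaPlus σ, fun x v => ⟨Iff.rfl, Iff.rfl⟩⟩, hcl⟩,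
    hcl, fun x => ?_⟩
  let j : C(Fin (l + 1) → ℝ, TotallyRealField.Cover l) := ⟨fun y => (0, A y), by fun_prop⟩
  exact injective_fundamentalGroup_map_of_lift (j := j) Torus.isAddQuotientCoveringMap_mk
    (TotallyRealField.isCoveringMap_proj σ)
    (fun a b h => A.injective (congrArg Prod.snd h))
    (fun y => TotallyRealField.fibreTorus_mk hA y) x
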